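/- Let $0<\alpha<4$, $\alpha\neq 2$, and $y>0$, and let $S=S(T)$ be positive integers with $T/S\to y$ as $T\to\infty$. For every $T$ let $\Sigma=\operatorname{diag}(\sigma_1,\dots,\sigma_T)$, where $\sigma_1,\dots,\sigma_T$ are i.i.d. real random variables whose law does not depend on $T$ and is heavy-tailed with tail exponent $\alpha$, i.e. the tail of $|\sigma_i|$ is regularly varying with index $-\alpha$: $$\lim_{x\to\infty}\frac{\mathbb P(|\sigma_i|>tx)}{\mathbb P(|\sigma_i|>x)}=t^{-\alpha}\qquad\text{for every } t>0.$$ Let $Z$ be a $T\times S$ random matrix, independent of $\Sigma$, with i.i.d. real or complex entries whose law does not depend on $T$ and which satisfy $\mathbb E Z_{ts}=0$, $\mathbb E|Z_{ts}|^2=1$ and $\mathbb E|Z_{ts}|^k<\infty$ for all $k\in\mathbb N$. Let $H$ be the c.d.f. of $\sigma_i^2$ and suppose that the real numbers $a_T$ satisfy $1-H(a_T)=\frac1T$ for all sufficiently large $T$. For a Hermitian matrix $A$ with eigenvalues $\lambda_i$ write $\lambda_{\max}[A]=\max_i|\lambda_i|$. Then, as $T\to\infty$, $$\frac{\lambda_{\max}\left[\Sigma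 Z Z^*\Sigma\right]}{S\,a_T}\ \xrightarrow{\ d\ }\ \xi,$$ where $\xi$ has the Fréchet law $\mathbb P(\xi\le x)=\exp\left(-x^{-\alpha/2}\right)$ for $x>0$ and $\mathbb P(\xi\le x)=0$ for $x\le 0$. -/

import Mathlib

open MeasureTheory ProbabilityTheory Filter Topology
open scoped Matrix

/-- A law `μ` on `ℝ` is heavy-tailed (regularly varying) with tail exponent `α`: the tail
`G x = μ {s | x < |s|}` is regularly varying at infinity with index `-α`, that is,
`G (t x) / G x → t ^ (-α)` as `x → ∞`, for every `t > 0`.  (The case `t = 1` already forces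
`G x > 0` for all `x`, since `0 / 0 = 0`.) -/
def HasRegularlyVaryingTail (μ : Measure ℝ) (α : ℝ) : Prop :=
  ∀ t : ℝ, 0 < t →
    Tendsto (fun x : ℝ => μ.real {s : ℝ | t * x < |s|} / μ.real {s : ℝ | x < |s|})
      atTop (𝓝 (t ^ (-α)))

/-- The diagonal matrix with real diagonal entries `σ i`. -/
noncomputable def volMatrix {𝕜 : Type*} [RCLike 𝕜] {n : ℕ} (σ : Fin n → ℝ) :
    Matrix (Fin n) (Fin n) 𝕜 :=
  Matrix.diagonal fun i => (σ i : 𝕜)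

/-- The matrix `Σ Z Z* Σ`, where `Σ = diag (σ i)`. -/
noncomputable def ellipticMatrix {𝕜 : Type*} [RCLike 𝕜] {n m : ℕ} (σ : Fin n → ℝ)
    (Z : Matrix (Fin n) (Fin m) 𝕜) : Matrix (Fin n) (Fin n) 𝕜 :=
  (volMatrix σ : Matrix (Fin n) (Fin n) 𝕜) * Z * Zᴴ * (volMatrix σ : Matrix (Fin n) (Fin n) 𝕜)

theorem isHermitian_ellipticMatrix {𝕜 : Type*} [RCLike 𝕜] {n m : ℕ} (σ : Fin n → ℝ)
    (Z : Matrix (Fin n) (Fin m) 𝕜) : (ellipticMatrix σ Z).IsHermitian := by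
  have h : (volMatrix σ : Matrix (Fin n) (Fin n) 𝕜)ᴴ = volMatrix σ := by
    simp only [volMatrix, Matrix.diagonal_conjTranspose]
    congr 1
    funext i
    simp
  simp only [Matrix.IsHermitian, ellipticMatrix, Matrix.conjTranspose_mul,
    Matrix.conjTranspose_conjTranspose, h, Matrix.mul_assoc]

/-- `λ_max [A] = max_i |λ_i|` over the eigenvalues of a Hermitian matrix `A`
(and `0` for the `0 × 0` matrix). -/
noncomputable def lambdaMax {𝕜 : Type*} [RCLike 𝕜] {n : ℕ} {A : Matrix (Fin n) (Fin n) 𝕜}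
    (hA : A.IsHermitian) : ℝ :=
  ⨆ i, |hA.eigenvalues i|

section OperatorNorm

open scoped Matrix.Norms.L2Operator

/-- The largest absolute eigenvalue of a Hermitian matrix is its `ℓ²` operator norm. -/
theorem lambdaMax_eq_l2_opNorm {𝕜 : Type*} [RCLike 𝕜] {n : ℕ} {A : Matrix (Fin n) (Fin n) 𝕜}
    (hA : A.IsHermitian) : lambdaMax hA = ‖A‖ := by
  have h1 : ‖A‖ = ‖(fun i => (hA.eigenvalues i : 𝕜))‖ := by
    conv_lhs => rw [hA.spectral_theorem]
    rw [Unitary.conjStarAlgAut_apply, ← Unitary.coe_star, CStarRing.norm_mul_coe_unitary,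
      CStarRing.norm_coe_unitary_mul, Matrix.l2_opNorm_diagonal]
    rfl
  rw [h1, lambdaMax]
  rcases isEmpty_or_nonempty (Fin n) with h | h
  · simp [Real.iSup_of_isEmpty, Pi.norm_def]
  · refine le_antisymm (ciSup_le fun i => ?_) ?_
    · simpa using norm_le_pi_norm (fun i => (hA.eigenvalues i : 𝕜)) i
    · refine (pi_norm_le_iff_of_nonempty _).2 fun i => ?_
      simpa using le_ciSup (f := fun i => |hA.eigenvalues i|) (Set.finite_range _).bddAbove i

/-- The `ℓ²` operator norm is dominated by the Frobenius norm. -/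
theorem Matrix.l2_opNorm_le_sqrt_sum_sq {𝕜 : Type*} [RCLike 𝕜] {m n : Type*} [Fintype m]
    [Fintype n] [DecidableEq n] (A : Matrix m n 𝕜) :
    ‖A‖ ≤ √(∑ i, ∑ j, ‖A i j‖ ^ 2) := by
  rw [Matrix.l2_opNorm_def]
  refine ContinuousLinearMap.opNorm_le_bound _ (Real.sqrt_nonneg _) fun x => ?_
  rw [EuclideanSpace.norm_eq, EuclideanSpace.norm_eq,
    ← Real.sqrt_mul (Finset.sum_nonneg fun i _ => Finset.sum_nonneg fun j _ => sq_nonneg _)]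
  refine Real.sqrt_le_sqrt ?_
  rw [Finset.sum_mul]
  refine Finset.sum_le_sum fun i _ => ?_
  have h : ‖∑ j, A i j * x j‖ ≤ ∑ j, ‖A i j‖ * ‖x j‖ :=
    (norm_sum_le _ _).trans_eq (by simp)
  calc _ = ‖∑ j, A i j * x j‖ ^ 2 := by
        simp [Matrix.mulVec, dotProduct]
    _ ≤ (∑ j, ‖A i j‖ * ‖x j‖) ^ 2 := by gcongr
    _ ≤ _ := Finset.sum_mul_sq_le_sq_mul_sq _ _ _

theorem ellipticMatrix_apply {𝕜 : Type*} [RCLike 𝕜] {n m : ℕ} (σ : Fin n → ℝ)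
    (Z : Matrix (Fin n) (Fin m) 𝕜) (i k : Fin n) :
    ellipticMatrix σ Z i k = (σ i : 𝕜) * (∑ j, Z i j * star (Z k j)) * (σ k : 𝕜) := by
  simp only [ellipticMatrix, volMatrix, Matrix.mul_diagonal, Matrix.mul_assoc,
    Matrix.diagonal_mul]
  simp [Matrix.mul_apply, mul_assoc]

/-- The entry `(i, k)` of `Z Z* - m I`. -/
noncomputable def gramDefect {𝕜 : Type*} [RCLike 𝕜] {n m : ℕ} (Z : Fin n → Fin m → 𝕜)
    (i k : Fin n) : 𝕜 :=
  ∑ j, (Z i j * star (Z k j) - if i = k then 1 else 0)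

/-- `λ_max [Σ Z Z* Σ]` differs from `m max_i σ_i²` by at most the Frobenius norm of
`Σ (Z Z* - m I) Σ`. -/
theorem abs_lambdaMax_ellipticMatrix_sub_le {𝕜 : Type*} [RCLike 𝕜] {n m : ℕ} (σ : Fin n → ℝ)
    (Z : Matrix (Fin n) (Fin m) 𝕜) :
    |lambdaMax (isHermitian_ellipticMatrix σ Z) - m * ‖fun i => σ i ^ 2‖| ≤
      √(∑ i, ∑ k, σ i ^ 2 * σ k ^ 2 * ‖gramDefect Z i k‖ ^ 2) := by
  have h1 : (m : ℝ) * ‖fun i => σ i ^ 2‖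
      = ‖(Matrix.diagonal fun i => ((m : ℝ) * σ i ^ 2 : ℝ) : Matrix (Fin n) (Fin n) ℝ)‖ := by
    rw [Matrix.l2_opNorm_diagonal]
    have : (fun i => (m : ℝ) * σ i ^ 2) = (m : ℝ) • fun i => σ i ^ 2 := rfl
    rw [this, norm_smul]
    simp
  have h2 : (m : ℝ) * ‖fun i => σ i ^ 2‖
      = ‖(Matrix.diagonal fun i => (((m : ℝ) * σ i ^ 2 : ℝ) : 𝕜) : Matrix (Fin n) (Fin n) 𝕜)‖ := by
    rw [h1, Matrix.l2_opNorm_diagonal, Matrix.l2_opNorm_diagonal]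
    simp [Pi.norm_def]
  rw [lambdaMax_eq_l2_opNorm, h2]
  refine (abs_norm_sub_norm_le _ _).trans ((Matrix.l2_opNorm_le_sqrt_sum_sq _).trans_eq ?_)
  congr 1
  refine Finset.sum_congr rfl fun i _ => Finset.sum_congr rfl fun k _ => ?_
  have h3 : (ellipticMatrix σ Z - Matrix.diagonal fun i => (((m : ℝ) * σ i ^ 2 : ℝ) : 𝕜)) i k
      = (σ i : 𝕜) * (σ k : 𝕜) * gramDefect Z i k := by
    rw [Matrix.sub_apply, ellipticMatrix_apply]
    simp only [gramDefect, Finset.sum_sub_distrib]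
    by_cases h : i = k
    · subst h
      simp
      ring
    · simp [h]
      ring
  rw [h3, norm_mul, norm_mul, mul_pow, mul_pow]
  simp

theorem continuous_lambdaMax_ellipticMatrix {𝕜 : Type*} [RCLike 𝕜] {n m : ℕ} :
    Continuous fun p : (Fin n → ℝ) × (Fin n × Fin m → 𝕜) =>
      lambdaMax (isHermitian_ellipticMatrix p.1 (Matrix.of fun i j => p.2 (i, j))) := by
  simp_rw [lambdaMax_eq_l2_opNorm]
  refine continuous_norm.comp ?_
  refine continuous_matrix fun i k => ?_
  simp_rw [ellipticMatrix_apply]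
  simp only [Matrix.of_apply]
  fun_prop

end OperatorNorm

section RegularVariation

/-- The tail of the law of `s ^ 2`, for `s` of law `μ`. -/
noncomputable def sqTail (μ : Measure ℝ) (x : ℝ) : ℝ := μ.real {s : ℝ | x < s ^ 2}

/-- The mean of `s ^ 2` truncated at level `x`, for `s` of law `μ`. -/
noncomputable def sqTruncMean (μ : Measure ℝ) (x : ℝ) : ℝ := ∫ s, min (s ^ 2) x ∂μ

variable {μ : Measure ℝ} {α : ℝ}

theorem measurableSet_lt_sq (x : ℝ) : MeasurableSet {s : ℝ | x < s ^ 2} :=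
  measurableSet_lt measurable_const (by fun_prop)

theorem sqTail_nonneg (x : ℝ) : 0 ≤ sqTail μ x := measureReal_nonneg

theorem sqTail_antitone [IsProbabilityMeasure μ] : Antitone (sqTail μ) := fun _ _ h =>
  measureReal_mono fun _ hs => lt_of_le_of_lt h hs

theorem one_sub_cdf_map_sq [IsProbabilityMeasure μ] (x : ℝ) :
    1 - cdf (μ.map fun s : ℝ => s ^ 2) x = sqTail μ x := by
  have hm : Measurable fun s : ℝ => s ^ 2 := by fun_prop
  have : IsProbabilityMeasure (μ.map fun s : ℝ => s ^ 2) :=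
    Measure.isProbabilityMeasure_map hm.aemeasurable
  rw [cdf_eq_real, map_measureReal_apply hm measurableSet_Iic,
    ← probReal_compl_eq_one_sub (hm measurableSet_Iic)]
  congr 1
  ext s
  simp

theorem tendsto_sqTail_atTop [IsProbabilityMeasure μ] : Tendsto (sqTail μ) atTop (𝓝 0) := by
  have h := (tendsto_cdf_atTop (μ.map fun s : ℝ => s ^ 2)).const_sub 1
  simp only [sub_self, one_sub_cdf_map_sq] at h
  exact h

theorem HasRegularlyVaryingTail.tendsto_sqTail_div (h : HasRegularlyVaryingTail μ α) {t : ℝ}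
    (ht : 0 < t) :
    Tendsto (fun x => sqTail μ (t * x) / sqTail μ x) atTop (𝓝 (t ^ (-(α / 2)))) := by
  have h1 := (h (√t) (Real.sqrt_pos.2 ht)).comp Real.tendsto_sqrt_atTop
  have h2 : √t ^ (-α) = t ^ (-(α / 2)) := by
    rw [Real.sqrt_eq_rpow, ← Real.rpow_mul ht.le]
    congr 1
    ring
  rw [h2] at h1
  refine h1.congr' ?_
  filter_upwards [eventually_ge_atTop 0] with x hx
  have h3 : ∀ u : ℝ, 0 ≤ u → {s : ℝ | √u < |s|} = {s : ℝ | u < s ^ 2} := by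
    intro u hu
    ext s
    rw [Set.mem_ofPred_eq, Set.mem_ofPred_eq, ← Real.sqrt_sq_eq_abs, Real.sqrt_lt_sqrt_iff hu]
  simp only [Function.comp, sqTail]
  rw [← Real.sqrt_mul ht.le, h3 _ hx, h3 _ (by positivity)]

theorem HasRegularlyVaryingTail.sqTail_pos [IsProbabilityMeasure μ]
    (h : HasRegularlyVaryingTail μ α) (x : ℝ) :
    0 < sqTail μ x := by
  by_contra hx
  have hx0 : sqTail μ x = 0 := le_antisymm (not_lt.1 hx) (sqTail_nonneg x)
  have h1 := h.tendsto_sqTail_div one_pos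
  have h2 : Tendsto (fun x => sqTail μ (1 * x) / sqTail μ x) atTop (𝓝 0) := by
    refine tendsto_const_nhds.congr' ?_
    filter_upwards [eventually_ge_atTop x] with u hu
    have : sqTail μ u = 0 := le_antisymm ((sqTail_antitone hu).trans hx0.le) (sqTail_nonneg u)
    simp [this]
  simpa using tendsto_nhds_unique h1 h2

/-- A function that contracts under doubling of the argument, up to a vanishing error, tends
to zero. -/
theorem tendsto_zero_of_doubling {φ e : ℝ → ℝ} {q : ℝ} (hq0 : 0 ≤ q) (hq1 : q < 1)
    (h : ∀ᶠ x in atTop, φ (2 * x) ≤ q * φ x + e x) (he : Tendsto e atTop (𝓝 0))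
    (hφ : ∀ᶠ x in atTop, 0 ≤ φ x)
    (hb : ∀ᶠ x in atTop, ∃ M, ∀ u ∈ Set.Icc x (2 * x), φ u ≤ M) :
    Tendsto φ atTop (𝓝 0) := by
  rw [Metric.tendsto_atTop]
  intro ε hε
  have hε' : 0 < (1 - q) * (ε / 2) := mul_pos (by linarith) (by linarith)
  obtain ⟨x₀, hx₀⟩ := eventually_atTop.1
    ((h.and (he.eventually_lt_const hε')).and (hφ.and (hb.and (eventually_gt_atTop 0))))
  obtain ⟨M, hM⟩ := (hx₀ x₀ le_rfl).2.2.1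
  have hx₀pos : 0 < x₀ := (hx₀ x₀ le_rfl).2.2.2
  have key : ∀ n : ℕ, ∀ x ∈ Set.Icc (2 ^ n * x₀) (2 ^ (n + 1) * x₀),
      φ x ≤ q ^ n * M + ε / 2 := by
    intro n
    induction n with
    | zero =>
      intro x hx
      have := hM x (by simpa using hx)
      simp only [pow_zero, one_mul]
      linarith
    | succ n ih =>
      intro x hx
      have hx' : x / 2 ∈ Set.Icc (2 ^ n * x₀) (2 ^ (n + 1) * x₀) := by
        obtain ⟨h1, h2⟩ := hx
        constructor
        · rw [le_div_iff₀ two_pos]; refine le_trans (le_of_eq ?_) h1; ring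
        · rw [div_le_iff₀ two_pos]; refine h2.trans (le_of_eq ?_); ring
      have h3 : x₀ ≤ x / 2 :=
        le_trans (le_mul_of_one_le_left hx₀pos.le (one_le_pow₀ one_le_two)) hx'.1
      have h4 := (hx₀ _ h3).1
      rw [mul_div_cancel₀ x two_ne_zero] at h4
      have h5 := mul_le_mul_of_nonneg_left (ih _ hx') hq0
      calc φ x ≤ q * φ (x / 2) + e (x / 2) := h4.1
        _ ≤ q * (q ^ n * M + ε / 2) + (1 - q) * (ε / 2) := add_le_add h5 h4.2.le
        _ = _ := by ring
  have hlim : Tendsto (fun n : ℕ => q ^ n * M) atTop (𝓝 0) := by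
    simpa using (tendsto_pow_atTop_nhds_zero_of_lt_one hq0 hq1).mul_const M
  obtain ⟨N, hN⟩ := eventually_atTop.1 (hlim.eventually_lt_const (half_pos hε))
  refine ⟨2 ^ N * x₀, fun x hx => ?_⟩
  have hxx₀ : x₀ ≤ x :=
    le_trans (le_mul_of_one_le_left hx₀pos.le (one_le_pow₀ one_le_two)) hx
  obtain ⟨n, hn1, hn2⟩ := exists_nat_pow_near ((one_le_div hx₀pos).2 hxx₀) one_lt_two
  rw [le_div_iff₀ hx₀pos] at hn1
  rw [div_lt_iff₀ hx₀pos] at hn2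
  have hNn : N ≤ n := by
    have h1 : (2 : ℝ) ^ N < 2 ^ (n + 1) := lt_of_mul_lt_mul_right (hx.trans_lt hn2) hx₀pos.le
    have := (pow_lt_pow_iff_right₀ (one_lt_two (α := ℝ))).1 h1
    omega
  have h1 := key n x ⟨hn1, hn2.le⟩
  have h2 := hN n hNn
  have h3 := (hx₀ x hxx₀).2.1
  rw [Real.dist_eq, sub_zero, abs_of_nonneg h3]
  linarith

theorem integrable_min_sq [IsProbabilityMeasure μ]
    {x : ℝ} (hx : 0 ≤ x) : Integrable (fun s : ℝ => min (s ^ 2) x) μ := by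
  refine Integrable.of_bound (by fun_prop) x (ae_of_all _ fun s => ?_)
  rw [Real.norm_eq_abs, abs_of_nonneg (le_min (sq_nonneg s) hx)]
  exact min_le_right _ _

theorem sqTruncMean_nonneg {x : ℝ} (hx : 0 ≤ x) : 0 ≤ sqTruncMean μ x :=
  integral_nonneg fun s => le_min (sq_nonneg s) hx

theorem sqTruncMean_le [IsProbabilityMeasure μ] {x : ℝ} (hx : 0 ≤ x) : sqTruncMean μ x ≤ x := by
  have := integral_mono (integrable_min_sq (μ := μ) hx) (integrable_const x)
    fun s => min_le_right _ _
  simpa [sqTruncMean] using this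

theorem sqTruncMean_two_mul_le [IsProbabilityMeasure μ] {x : ℝ} (hx : 0 ≤ x) :
    sqTruncMean μ (2 * x) ≤ sqTruncMean μ x + x * sqTail μ x := by
  have h1 : x * sqTail μ x = ∫ s, {s : ℝ | x < s ^ 2}.indicator (fun _ => x) s ∂μ := by
    rw [integral_indicator_const _ (measurableSet_lt_sq x), smul_eq_mul, mul_comm, sqTail]
  have h2 : Integrable ({s : ℝ | x < s ^ 2}.indicator fun _ => x) μ :=
    (integrable_const x).indicator (measurableSet_lt_sq x)
  rw [h1, sqTruncMean, sqTruncMean, ← integral_add (integrable_min_sq hx) h2]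
  refine integral_mono (integrable_min_sq (by positivity)) ((integrable_min_sq hx).add h2) ?_
  intro s
  by_cases hs : x < s ^ 2
  · simp only [Set.indicator, Set.mem_ofPred_eq, hs, if_true, min_eq_right hs.le]
    linarith [min_le_right (s ^ 2) (2 * x)]
  · simp only [Set.indicator, Set.mem_ofPred_eq, hs, if_false, min_eq_left (not_lt.1 hs)]
    linarith [min_le_left (s ^ 2) (2 * x)]

/-- For a tail exponent below `4`, the mean of `s ^ 2` truncated at `x` is negligible against
`x √G(x)`, with `G` the tail of `s ^ 2`. -/
theorem HasRegularlyVaryingTail.tendsto_sqTruncMean_div [IsProbabilityMeasure μ]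
    (h : HasRegularlyVaryingTail μ α)
    (hα : α < 4) :
    Tendsto (fun x => sqTruncMean μ x / (x * √(sqTail μ x))) atTop (𝓝 0) := by
  have hρ : Tendsto (fun x => √(sqTail μ x) / (2 * √(sqTail μ (2 * x)))) atTop
      (𝓝 ((2 : ℝ) ^ (α / 4 - 1))) := by
    have h1 := ((h.tendsto_sqTail_div two_pos).inv₀ (by positivity)).sqrt.div_const 2
    have h2 : √((2 : ℝ) ^ (-(α / 2)))⁻¹ / 2 = 2 ^ (α / 4 - 1) := by
      rw [← Real.rpow_neg two_pos.le, Real.sqrt_eq_rpow, ← Real.rpow_mul two_pos.le,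
        Real.rpow_sub_one two_ne_zero]
      congr 2
      ring
    rw [h2] at h1
    refine h1.congr fun x => ?_
    rw [inv_div, Real.sqrt_div (sqTail_nonneg x), div_div, mul_comm]
  have hlt : (2 : ℝ) ^ (α / 4 - 1) < 1 :=
    Real.rpow_lt_one_of_one_lt_of_neg one_lt_two (by linarith)
  obtain ⟨q, hq1, hq2⟩ := exists_between hlt
  have hq0 : 0 ≤ q := (Real.rpow_nonneg two_pos.le _).trans hq1.le
  refine tendsto_zero_of_doubling (e := fun x => √(sqTail μ x)) hq0 hq2 ?_ ?_ ?_ ?_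
  · filter_upwards [hρ.eventually_lt_const hq1, eventually_gt_atTop 0] with x hx hx0
    have hG : 0 < √(sqTail μ x) := Real.sqrt_pos.2 (h.sqTail_pos x)
    have hG2 : 0 < √(sqTail μ (2 * x)) := Real.sqrt_pos.2 (h.sqTail_pos _)
    have hsq : √(sqTail μ x) * √(sqTail μ x) = sqTail μ x := Real.mul_self_sqrt (sqTail_nonneg x)
    have h0 : 0 ≤ sqTruncMean μ x / (x * √(sqTail μ x)) + √(sqTail μ x) :=
      add_nonneg (div_nonneg (sqTruncMean_nonneg hx0.le) (by positivity)) hG.le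
    calc sqTruncMean μ (2 * x) / (2 * x * √(sqTail μ (2 * x)))
        ≤ (sqTruncMean μ x + x * sqTail μ x) / (2 * x * √(sqTail μ (2 * x))) := by
          gcongr
          exact sqTruncMean_two_mul_le hx0.le
      _ = (√(sqTail μ x) / (2 * √(sqTail μ (2 * x)))) *
          (sqTruncMean μ x / (x * √(sqTail μ x)) + √(sqTail μ x)) := by
          nth_rewrite 1 [← hsq]
          field_simp
      _ ≤ q * (sqTruncMean μ x / (x * √(sqTail μ x)) + √(sqTail μ x)) := by gcongr
      _ ≤ q * (sqTruncMean μ x / (x * √(sqTail μ x))) + √(sqTail μ x) := by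
          rw [mul_add]
          gcongr
          exact mul_le_of_le_one_left hG.le hq2.le
  · simpa using (tendsto_sqTail_atTop (μ := μ)).sqrt
  · filter_upwards [eventually_ge_atTop 0] with x hx
    exact div_nonneg (sqTruncMean_nonneg hx) (by positivity)
  · filter_upwards [eventually_gt_atTop 0] with x hx
    refine ⟨1 / √(sqTail μ (2 * x)), fun u hu => ?_⟩
    have hu0 : 0 < u := hx.trans_le hu.1
    have hG2 : 0 < √(sqTail μ (2 * x)) := Real.sqrt_pos.2 (h.sqTail_pos _)
    calc sqTruncMean μ u / (u * √(sqTail μ u)) ≤ u / (u * √(sqTail μ (2 * x))) := by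
          gcongr
          · exact sqTruncMean_le hu0.le
          · exact sqTail_antitone hu.2
      _ = _ := by field_simp

theorem HasRegularlyVaryingTail.tendsto_atTop_of_sqTail_eq [IsProbabilityMeasure μ]
    (h : HasRegularlyVaryingTail μ α)
    {a : ℕ → ℝ} (ha : ∀ᶠ n : ℕ in atTop, sqTail μ (a n) = 1 / (n : ℝ)) :
    Tendsto a atTop atTop := by
  refine tendsto_atTop.2 fun b => ?_
  filter_upwards [ha, (tendsto_one_div_atTop_nhds_zero_nat (𝕜 := ℝ)).eventually_lt_const
    (h.sqTail_pos b)] with n hn hb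
  by_contra hlt
  rw [← hn] at hb
  exact absurd (sqTail_antitone (μ := μ) (not_le.1 hlt).le) (not_le.2 hb)

/-- Along levels `a n` with `G(a n) = 1 / n`, `n G(t a n) → t ^ (-α / 2)`, with `G` the tail of
`s ^ 2`. -/
theorem HasRegularlyVaryingTail.tendsto_mul_sqTail [IsProbabilityMeasure μ]
    (h : HasRegularlyVaryingTail μ α)
    {a : ℕ → ℝ} (ha : ∀ᶠ n : ℕ in atTop, sqTail μ (a n) = 1 / (n : ℝ)) {t : ℝ} (ht : 0 < t) :
    Tendsto (fun n : ℕ => n * sqTail μ (t * a n)) atTop (𝓝 (t ^ (-(α / 2)))) := by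
  refine ((h.tendsto_sqTail_div ht).comp (h.tendsto_atTop_of_sqTail_eq ha)).congr' ?_
  filter_upwards [ha] with n hn
  simp only [Function.comp, hn]
  rw [div_div_eq_mul_div, div_one, mul_comm]

/-- The truncated second moments at level `K a n` are negligible, where `G(a n) = 1 / n`. -/
theorem HasRegularlyVaryingTail.tendsto_sqTruncMean_mul_sqrt [IsProbabilityMeasure μ]
    (h : HasRegularlyVaryingTail μ α)
    (hα : α < 4) {a : ℕ → ℝ} (ha : ∀ᶠ n : ℕ in atTop, sqTail μ (a n) = 1 / (n : ℝ)) {K : ℝ}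
    (hK : 1 ≤ K) :
    Tendsto (fun n : ℕ => sqTruncMean μ (K * a n) * √n / a n) atTop (𝓝 0) := by
  have ha' := h.tendsto_atTop_of_sqTail_eq ha
  have h1 := ((h.tendsto_sqTruncMean_div hα).comp
    (ha'.const_mul_atTop (zero_lt_one.trans_le hK))).const_mul K
  rw [mul_zero] at h1
  refine squeeze_zero' ?_ ?_ h1
  · filter_upwards [ha'.eventually_gt_atTop 0] with n hn
    exact div_nonneg (mul_nonneg (sqTruncMean_nonneg (by positivity)) (Real.sqrt_nonneg _)) hn.le
  · filter_upwards [ha'.eventually_gt_atTop 0, ha, eventually_gt_atTop 0] with n hn hna hn0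
    have hKpos : 0 < K := zero_lt_one.trans_le hK
    have hG : 0 < √(sqTail μ (K * a n)) := Real.sqrt_pos.2 (h.sqTail_pos _)
    have hn0' : (0 : ℝ) < n := by exact_mod_cast hn0
    have hG1 : √(sqTail μ (K * a n)) * √n ≤ 1 := by
      rw [← Real.sqrt_mul (sqTail_nonneg _)]
      refine Real.sqrt_le_one.2 ?_
      have := sqTail_antitone (μ := μ) (le_mul_of_one_le_left hn.le hK)
      rw [hna] at this
      calc _ ≤ 1 / (n : ℝ) * n := by gcongr
        _ = 1 := by field_simp
    simp only [Function.comp]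
    calc sqTruncMean μ (K * a n) * √n / a n
        = (sqTruncMean μ (K * a n) / a n / √(sqTail μ (K * a n))) *
          (√(sqTail μ (K * a n)) * √n) := by field_simp
      _ ≤ (sqTruncMean μ (K * a n) / a n / √(sqTail μ (K * a n))) * 1 := by
          gcongr
          exact div_nonneg (div_nonneg (sqTruncMean_nonneg (by positivity)) hn.le) hG.le
      _ = _ := by field_simp

end RegularVariation

section Moments

variable {𝕜 : Type*} [RCLike 𝕜] {Ω : Type*} [MeasurableSpace Ω] {P : Measure Ω}

/-- The second moment of a sum of pairwise independent centred variables is the sum of the second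
moments. -/
theorem integral_norm_sq_sum_of_pairwise_indepFun [IsProbabilityMeasure P] {ι : Type*} [Fintype ι]
    {X : ι → Ω → 𝕜} (hX : ∀ i, MemLp (X i) 2 P) (h0 : ∀ i, ∫ ω, X i ω ∂P = 0)
    (hind : Pairwise fun i j => IndepFun (X i) (X j) P) :
    ∫ ω, ‖∑ i, X i ω‖ ^ 2 ∂P = ∑ i, ∫ ω, ‖X i ω‖ ^ 2 ∂P := by
  have key : ∀ f : 𝕜 →L[ℝ] ℝ,
      (∫ ω, (f (∑ i, X i ω)) ^ 2 ∂P = ∑ i, ∫ ω, (f (X i ω)) ^ 2 ∂P) := by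
    intro f
    have hf : ∀ i, MemLp (fun ω => f (X i ω)) 2 P := fun i => f.comp_memLp' (hX i)
    have hf0 : ∀ i, ∫ ω, f (X i ω) ∂P = 0 := fun i => by
      rw [f.integral_comp_comm ((hX i).integrable one_le_two), h0, map_zero]
    have h1 := IndepFun.variance_sum (s := Finset.univ) (fun i _ => hf i)
      (fun i _ j _ hij => (hind hij).comp f.measurable f.measurable)
    have h2 : ∀ i, variance (fun ω => f (X i ω)) P = ∫ ω, (f (X i ω)) ^ 2 ∂P := fun i =>
      variance_of_integral_eq_zero (hf i).aemeasurable (hf0 i)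
    have h3 : ∫ ω, (∑ i, fun ω => f (X i ω)) ω ∂P = 0 := by
      simp only [Finset.sum_apply]
      rw [integral_finsetSum _ fun i _ => (hf i).integrable one_le_two]
      simp [hf0]
    rw [variance_of_integral_eq_zero (memLp_finsetSum' _ fun i _ => hf i).aemeasurable h3] at h1
    simp only [h2] at h1
    rw [← h1]
    simp [map_sum]
  have hsum : MemLp (fun ω => ∑ i, X i ω) 2 P := memLp_finsetSum _ fun i _ => hX i
  have split : ∀ {Y : Ω → 𝕜}, MemLp Y 2 P → ∫ ω, ‖Y ω‖ ^ 2 ∂P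
      = ∫ ω, (RCLike.reCLM (Y ω)) ^ 2 ∂P + ∫ ω, (RCLike.imCLM (Y ω)) ^ 2 ∂P := by
    intro Y hY
    have h1 : Integrable (fun ω => (RCLike.reCLM (Y ω)) ^ 2) P := hY.re.integrable_sq
    have h2 : Integrable (fun ω => (RCLike.imCLM (Y ω)) ^ 2) P := hY.im.integrable_sq
    rw [← integral_add h1 h2]
    refine integral_congr_ae (ae_of_all _ fun ω => ?_)
    simp only [RCLike.reCLM_apply, RCLike.imCLM_apply]
    rw [RCLike.norm_sq_eq_def, sq, sq]
  rw [split hsum, key RCLike.reCLM, key RCLike.imCLM, ← Finset.sum_add_distrib]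
  exact Finset.sum_congr rfl fun i _ => (split (hX i)).symm

variable {μ : Measure 𝕜} {n m : ℕ} {Z : Fin n → Fin m → Ω → 𝕜}

theorem memLp_four_of_hasLaw (hμ4 : Integrable (fun z : 𝕜 => ‖z‖ ^ 4) μ) {X : Ω → 𝕜}
    (hX : HasLaw X μ P) : MemLp X 4 P := by
  have h1 : MemLp (fun z : 𝕜 => z) 4 μ := by
    rw [← integrable_norm_rpow_iff (by fun_prop) (by simp) (by simp)]
    simpa using hμ4
  rw [← hX.map_eq] at h1
  exact h1.comp_of_map hX.aemeasurable

theorem integral_norm_pow_four_of_hasLaw {X : Ω → 𝕜} (hX : HasLaw X μ P) :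
    ∫ ω, ‖X ω‖ ^ 4 ∂P = ∫ z, ‖z‖ ^ 4 ∂μ :=
  hX.integral_comp (f := fun z : 𝕜 => ‖z‖ ^ 4) (by fun_prop)

instance ENNReal.holderTriple_four_four_two : ENNReal.HolderTriple 4 4 2 where
  inv_add_inv_eq_inv := by
    rw [← two_mul, show (4 : ENNReal) = 2 * 2 by norm_num,
      ENNReal.mul_inv (by simp) (by simp), ← mul_assoc, ENNReal.mul_inv_cancel (by simp) (by simp),
      one_mul]

/-- The second moment of an entry of `Z Z* - m I`, for a matrix `Z` with independent standardized
entries. -/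
theorem integral_norm_sq_gramDefect_le [IsProbabilityMeasure P]
    (hμ4 : Integrable (fun z : 𝕜 => ‖z‖ ^ 4) μ) (hμ0 : ∫ z, z ∂μ = 0)
    (hμ1 : ∫ z, ‖z‖ ^ 2 ∂μ = 1) (hZ : ∀ i j, HasLaw (Z i j) μ P)
    (hind : iIndepFun (fun p : Fin n × Fin m => Z p.1 p.2) P) (i k : Fin n) :
    Integrable (fun ω => ‖gramDefect (fun i j => Z i j ω) i k‖ ^ 2) P ∧
      ∫ ω, ‖gramDefect (fun i j => Z i j ω) i k‖ ^ 2 ∂P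
        ≤ m * (2 * ∫ z, ‖z‖ ^ 4 ∂μ + 2) := by
  set d : 𝕜 := if i = k then 1 else 0 with hd
  have hdn : ‖d‖ ≤ 1 := by rw [hd]; split_ifs <;> simp
  have hae : ∀ p : Fin n × Fin m, AEMeasurable (Z p.1 p.2) P := fun p => (hZ _ _).aemeasurable
  have h4 : ∀ i j, MemLp (Z i j) 4 P := fun i j => memLp_four_of_hasLaw hμ4 (hZ i j)
  have hI4 : ∀ i j, Integrable (fun ω => ‖Z i j ω‖ ^ 4) P := fun i j => by
    simpa using (h4 i j).integrable_norm_pow (p := 4) (by norm_num)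
  have hprod : ∀ j, MemLp (fun ω => Z i j ω * star (Z k j ω)) 2 P := fun j =>
    MemLp.mul (p := 4) (q := 4) (h4 k j).star (h4 i j)
  have hX : ∀ j, MemLp (fun ω => Z i j ω * star (Z k j ω) - d) 2 P := fun j =>
    (hprod j).sub (memLp_const d)
  have hX0 : ∀ j, ∫ ω, (Z i j ω * star (Z k j ω) - d) ∂P = 0 := by
    intro j
    rw [integral_sub ((hprod j).integrable one_le_two) (integrable_const d)]
    simp only [integral_const, probReal_univ, one_smul]
    by_cases hik : i = k
    · subst hik
      have h1 : ∀ ω, Z i j ω * star (Z i j ω) = ((‖Z i j ω‖ ^ 2 : ℝ) : 𝕜) := fun ω => by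
        rw [RCLike.star_def, RCLike.mul_conj]; push_cast; rfl
      simp_rw [h1]
      rw [integral_ofReal]
      have h2 : ∫ ω, ‖Z i j ω‖ ^ 2 ∂P = 1 := by
        rw [← hμ1]
        exact (hZ i j).integral_comp (f := fun z : 𝕜 => ‖z‖ ^ 2) (by fun_prop)
      rw [h2]
      simp [hd]
    · have h1 : IndepFun (Z i j) (Z k j) P :=
        hind.indepFun (i := (i, j)) (j := (k, j)) (by simp [hik])
      have h2 := h1.integral_fun_comp_mul_comp (𝕜 := 𝕜) (f := fun z => z) (g := fun z => star z)
        (hae (i, j)) (hae (k, j)) (by fun_prop) (by fun_prop)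
      have h3 : ∫ ω, Z i j ω ∂P = 0 := by
        rw [← hμ0]
        exact (hZ i j).integral_eq
      rw [h2, h3]
      simp [hd, hik]
  have hpair : Pairwise fun j l => IndepFun (fun ω => Z i j ω * star (Z k j ω) - d)
      (fun ω => Z i l ω * star (Z k l ω) - d) P := by
    intro j l hjl
    have h1 := hind.indepFun_prodMk_prodMk₀ hae (i, j) (k, j) (i, l) (k, l)
      (by simp [hjl]) (by simp [hjl]) (by simp [hjl]) (by simp [hjl])
    have hg : Measurable fun p : 𝕜 × 𝕜 => p.1 * star p.2 - d := by fun_prop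
    exact h1.comp hg hg
  refine ⟨?_, ?_⟩
  · exact (memLp_finsetSum Finset.univ fun j _ => hX j).integrable_norm_pow (p := 2) (by norm_num)
  · change ∫ ω, ‖∑ j, (Z i j ω * star (Z k j ω) - d)‖ ^ 2 ∂P ≤ _
    rw [integral_norm_sq_sum_of_pairwise_indepFun hX hX0 hpair]
    have hle : ∀ j, ∫ ω, ‖Z i j ω * star (Z k j ω) - d‖ ^ 2 ∂P ≤ 2 * ∫ z, ‖z‖ ^ 4 ∂μ + 2 := by
      intro j
      have h1 : ∫ ω, ‖Z i j ω * star (Z k j ω) - d‖ ^ 2 ∂P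
          ≤ ∫ ω, (‖Z i j ω‖ ^ 4 + ‖Z k j ω‖ ^ 4 + 2) ∂P := by
        refine integral_mono ((hX j).integrable_norm_pow (p := 2) (by norm_num))
          (((hI4 i j).add (hI4 k j)).add (integrable_const 2)) fun ω => ?_
        have h2 : ‖Z i j ω * star (Z k j ω) - d‖ ≤ ‖Z i j ω‖ * ‖Z k j ω‖ + 1 := by
          refine (norm_sub_le _ _).trans (add_le_add ?_ hdn)
          rw [norm_mul, norm_star]
        have h3 : ‖Z i j ω * star (Z k j ω) - d‖ ^ 2 ≤ (‖Z i j ω‖ * ‖Z k j ω‖ + 1) ^ 2 := by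
          gcongr
        refine h3.trans ?_
        nlinarith [sq_nonneg (‖Z i j ω‖ * ‖Z k j ω‖ - 1),
          sq_nonneg (‖Z i j ω‖ ^ 2 - ‖Z k j ω‖ ^ 2)]
      rw [integral_add (f := fun ω => ‖Z i j ω‖ ^ 4 + ‖Z k j ω‖ ^ 4) ((hI4 i j).add (hI4 k j))
          (integrable_const 2), integral_add (hI4 i j) (hI4 k j),
        integral_norm_pow_four_of_hasLaw (hZ i j),
        integral_norm_pow_four_of_hasLaw (hZ k j)] at h1
      simp only [integral_const, probReal_univ, one_smul] at h1
      linarith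
    refine (Finset.sum_le_sum fun j _ => hle j).trans_eq ?_
    simp [mul_add]

end Moments

section Truncation

variable {𝕜 : Type*} [RCLike 𝕜] {Ω : Type*} [MeasurableSpace Ω] {P : Measure Ω}
  [IsProbabilityMeasure P] {μσ : Measure ℝ} {μ : Measure 𝕜} {n m : ℕ}
  {σ : Fin n → Ω → ℝ} {Z : Fin n → Fin m → Ω → 𝕜}

theorem integral_min_sq_mul_min_sq_le (hσ : ∀ i, HasLaw (σ i) μσ P) (hσind : iIndepFun σ P)
    {x : ℝ} (hx : 0 ≤ x) (i k : Fin n) :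
    Integrable (fun ω => min (σ i ω ^ 2) x * min (σ k ω ^ 2) x) P ∧
    ∫ ω, min (σ i ω ^ 2) x * min (σ k ω ^ 2) x ∂P
      ≤ sqTruncMean μσ x ^ 2 + if i = k then x * sqTruncMean μσ x else 0 := by
  have hae := fun i => (hσ i).aemeasurable
  have hmean : ∀ i, ∫ ω, min (σ i ω ^ 2) x ∂P = sqTruncMean μσ x := fun i =>
    (hσ i).integral_comp (f := fun s : ℝ => min (s ^ 2) x) (by fun_prop)
  have hnn : ∀ i ω, 0 ≤ min (σ i ω ^ 2) x := fun i ω => le_min (sq_nonneg _) hx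
  have hbd : ∀ i ω, min (σ i ω ^ 2) x ≤ x := fun i ω => min_le_right _ _
  have hint1 : ∀ i, Integrable (fun ω => min (σ i ω ^ 2) x) P := fun i => by
    have := hae i
    refine Integrable.of_bound (by fun_prop) x (ae_of_all _ fun ω => ?_)
    rw [Real.norm_of_nonneg (hnn i ω)]
    exact hbd i ω
  have hint : Integrable (fun ω => min (σ i ω ^ 2) x * min (σ k ω ^ 2) x) P := by
    have := hae i
    have := hae k
    refine Integrable.of_bound (by fun_prop) (x * x) (ae_of_all _ fun ω => ?_)
    rw [Real.norm_of_nonneg (mul_nonneg (hnn i ω) (hnn k ω))]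
    exact mul_le_mul (hbd i ω) (hbd k ω) (hnn k ω) hx
  refine ⟨hint, ?_⟩
  split_ifs with hik
  · subst hik
    have h1 : ∫ ω, min (σ i ω ^ 2) x * min (σ i ω ^ 2) x ∂P
        ≤ ∫ ω, x * min (σ i ω ^ 2) x ∂P :=
      integral_mono hint ((hint1 i).const_mul x) fun ω =>
        mul_le_mul_of_nonneg_right (hbd i ω) (hnn i ω)
    rw [integral_const_mul, hmean] at h1
    nlinarith [sq_nonneg (sqTruncMean μσ x)]
  · have h1 := (hσind.indepFun hik).integral_fun_comp_mul_comp (𝕜 := ℝ)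
      (f := fun s => min (s ^ 2) x) (g := fun s => min (s ^ 2) x) (hae i) (hae k)
      (by fun_prop) (by fun_prop)
    rw [h1, hmean, hmean, add_zero, sq]

theorem measurable_gramDefect (i k : Fin n) :
    Measurable fun z : Fin n × Fin m → 𝕜 => gramDefect (fun i j => z (i, j)) i k := by
  unfold gramDefect
  fun_prop

/-- The expected squared Frobenius norm of `Σ (Z Z* - m I) Σ`, with the squares of the entries of
`Σ` truncated at `x`. -/
theorem integral_truncated_frobenius_le (hσ : ∀ i, HasLaw (σ i) μσ P) (hσind : iIndepFun σ P)
    (hμ4 : Integrable (fun z : 𝕜 => ‖z‖ ^ 4) μ) (hμ0 : ∫ z, z ∂μ = 0)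
    (hμ1 : ∫ z, ‖z‖ ^ 2 ∂μ = 1) (hZ : ∀ i j, HasLaw (Z i j) μ P)
    (hind : iIndepFun (fun p : Fin n × Fin m => Z p.1 p.2) P)
    (hσZ : IndepFun (fun ω i => σ i ω) (fun ω (p : Fin n × Fin m) => Z p.1 p.2 ω) P)
    {x : ℝ} (hx : 0 ≤ x) :
    Integrable (fun ω => ∑ i, ∑ k, min (σ i ω ^ 2) x * min (σ k ω ^ 2) x *
      ‖gramDefect (fun i j => Z i j ω) i k‖ ^ 2) P ∧
    ∫ ω, ∑ i, ∑ k, min (σ i ω ^ 2) x * min (σ k ω ^ 2) x *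
      ‖gramDefect (fun i j => Z i j ω) i k‖ ^ 2 ∂P
      ≤ m * (2 * ∫ z, ‖z‖ ^ 4 ∂μ + 2) *
        (n ^ 2 * sqTruncMean μσ x ^ 2 + n * (x * sqTruncMean μσ x)) := by
  have haeσ : AEMeasurable (fun ω i => σ i ω) P :=
    aemeasurable_pi_lambda _ fun i => (hσ i).aemeasurable
  have haeZ : AEMeasurable (fun ω (p : Fin n × Fin m) => Z p.1 p.2 ω) P :=
    aemeasurable_pi_lambda _ fun p => (hZ _ _).aemeasurable
  have hw := integral_min_sq_mul_min_sq_le hσ hσind hx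
  have hg := integral_norm_sq_gramDefect_le hμ4 hμ0 hμ1 hZ hind
  have hfm : ∀ i k : Fin n, Measurable fun s : Fin n → ℝ => min (s i ^ 2) x * min (s k ^ 2) x :=
    fun i k => by fun_prop
  have hgm : ∀ i k : Fin n, Measurable fun z : Fin n × Fin m → 𝕜 =>
      ‖gramDefect (fun i j => z (i, j)) i k‖ ^ 2 :=
    fun i k => (measurable_gramDefect i k).norm.pow_const 2
  have hint : ∀ i k, Integrable (fun ω => min (σ i ω ^ 2) x * min (σ k ω ^ 2) x *
      ‖gramDefect (fun i j => Z i j ω) i k‖ ^ 2) P := fun i k =>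
    (hσZ.comp (hfm i k) (hgm i k)).integrable_mul (hw i k).1 (hg i k).1
  refine ⟨integrable_finsetSum _ fun i _ => integrable_finsetSum _ fun k _ => hint i k, ?_⟩
  rw [integral_finsetSum _ fun i _ => integrable_finsetSum _ fun k _ => hint i k]
  simp_rw [integral_finsetSum _ fun k _ => hint _ k]
  have hle : ∀ i k, ∫ ω, min (σ i ω ^ 2) x * min (σ k ω ^ 2) x *
      ‖gramDefect (fun i j => Z i j ω) i k‖ ^ 2 ∂P
      ≤ (sqTruncMean μσ x ^ 2 + if i = k then x * sqTruncMean μσ x else 0) *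
        (m * (2 * ∫ z, ‖z‖ ^ 4 ∂μ + 2)) := by
    intro i k
    have h1 := hσZ.integral_fun_comp_mul_comp (𝕜 := ℝ) haeσ haeZ
      (hfm i k).aestronglyMeasurable (hgm i k).aestronglyMeasurable
    rw [h1]
    have hM := sqTruncMean_nonneg (μ := μσ) hx
    refine mul_le_mul (hw i k).2 (hg i k).2 (integral_nonneg fun ω => sq_nonneg _) ?_
    split_ifs <;> positivity
  refine (Finset.sum_le_sum fun i _ => Finset.sum_le_sum fun k _ => hle i k).trans_eq ?_
  simp_rw [← Finset.sum_mul, Finset.sum_add_distrib]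
  simp
  ring

/-- `λ_max [Σ Z Z* Σ]` is close to `m max_i σ_i²` with an explicit probability. -/
theorem measureReal_abs_lambdaMax_sub_ge_le (hσ : ∀ i, HasLaw (σ i) μσ P) (hσind : iIndepFun σ P)
    (hμ4 : Integrable (fun z : 𝕜 => ‖z‖ ^ 4) μ) (hμ0 : ∫ z, z ∂μ = 0)
    (hμ1 : ∫ z, ‖z‖ ^ 2 ∂μ = 1) (hZ : ∀ i j, HasLaw (Z i j) μ P)
    (hind : iIndepFun (fun p : Fin n × Fin m => Z p.1 p.2) P)
    (hσZ : IndepFun (fun ω i => σ i ω) (fun ω (p : Fin n × Fin m) => Z p.1 p.2 ω) P)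
    {x δ : ℝ} (hx : 0 ≤ x) (hδ : 0 < δ) :
    P.real {ω | δ ≤ |lambdaMax (isHermitian_ellipticMatrix (fun i => σ i ω)
        (Matrix.of fun i j => Z i j ω)) - m * ‖fun i => σ i ω ^ 2‖|}
      ≤ n * sqTail μσ x + m * (2 * ∫ z, ‖z‖ ^ 4 ∂μ + 2) *
        (n ^ 2 * sqTruncMean μσ x ^ 2 + n * (x * sqTruncMean μσ x)) / δ ^ 2 := by
  obtain ⟨hint, hle⟩ := integral_truncated_frobenius_le hσ hσind hμ4 hμ0 hμ1 hZ hind hσZ hx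
  set F : Ω → ℝ := fun ω => ∑ i, ∑ k, min (σ i ω ^ 2) x * min (σ k ω ^ 2) x *
      ‖gramDefect (fun i j => Z i j ω) i k‖ ^ 2 with hF
  have hF0 : ∀ ω, 0 ≤ F ω := fun ω => Finset.sum_nonneg fun i _ => Finset.sum_nonneg fun k _ =>
    mul_nonneg (mul_nonneg (le_min (sq_nonneg _) hx) (le_min (sq_nonneg _) hx)) (sq_nonneg _)
  have hsub : {ω | δ ≤ |lambdaMax (isHermitian_ellipticMatrix (fun i => σ i ω)
        (Matrix.of fun i j => Z i j ω)) - m * ‖fun i => σ i ω ^ 2‖|}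
      ⊆ (⋃ i, {ω | x < σ i ω ^ 2}) ∪ {ω | δ ^ 2 ≤ F ω} := by
    intro ω hω
    by_cases hbig : ∃ i, x < σ i ω ^ 2
    · exact Or.inl (Set.mem_iUnion.2 hbig)
    · push Not at hbig
      refine Or.inr ?_
      have h1 := le_trans hω (abs_lambdaMax_ellipticMatrix_sub_le (fun i => σ i ω)
        (Matrix.of fun i j => Z i j ω))
      have h2 := (Real.le_sqrt' hδ).1 h1
      change δ ^ 2 ≤ F ω
      simp only [hF, min_eq_left (hbig _)]
      exact h2
  have h1 : P.real (⋃ i, {ω | x < σ i ω ^ 2}) ≤ n * sqTail μσ x := by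
    refine (measureReal_iUnion_fintype_le _).trans_eq ?_
    have : ∀ i, P.real {ω | x < σ i ω ^ 2} = sqTail μσ x := fun i =>
      (hσ i).measureReal_eq (measurableSet_lt_sq x)
    simp [this]
  have h2 : P.real {ω | δ ^ 2 ≤ F ω} ≤ m * (2 * ∫ z, ‖z‖ ^ 4 ∂μ + 2) *
        (n ^ 2 * sqTruncMean μσ x ^ 2 + n * (x * sqTruncMean μσ x)) / δ ^ 2 := by
    rw [le_div_iff₀ (by positivity), mul_comm]
    exact (mul_meas_ge_le_integral_of_nonneg (ae_of_all _ hF0) hint _).trans hle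
  exact (measureReal_mono hsub).trans ((measureReal_union_le _ _).trans (add_le_add h1 h2))

end Truncation

/-- The law of the maximum of the independent variables `σ_i²`. -/
theorem measureReal_norm_sq_le {Ω : Type*} [MeasurableSpace Ω] {P : Measure Ω} {μσ : Measure ℝ}
    [IsProbabilityMeasure μσ] {n : ℕ} {σ : Fin n → Ω → ℝ} (hσ : ∀ i, HasLaw (σ i) μσ P)
    (hσind : iIndepFun σ P)
    {x : ℝ} (hx : 0 ≤ x) :
    P.real {ω | ‖fun i => σ i ω ^ 2‖ ≤ x} = (1 - sqTail μσ x) ^ n := by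
  have hset : {ω | ‖fun i => σ i ω ^ 2‖ ≤ x}
      = ⋂ i ∈ Finset.univ, σ i ⁻¹' {s : ℝ | x < s ^ 2}ᶜ := by
    ext ω
    simp [pi_norm_le_iff_of_nonneg hx]
  rw [hset, measureReal_def, hσind.measure_inter_preimage_eq_mul _
    (sets := fun _ => {s : ℝ | x < s ^ 2}ᶜ) fun i _ => (measurableSet_lt_sq x).compl,
    ENNReal.toReal_prod]
  have : ∀ i, (P (σ i ⁻¹' {s : ℝ | x < s ^ 2}ᶜ)).toReal = 1 - sqTail μσ x := fun i => by
    rw [← measureReal_def, sqTail, ← probReal_compl_eq_one_sub (measurableSet_lt_sq x)]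
    exact (hσ i).measureReal_eq (measurableSet_lt_sq x).compl
  rw [Finset.prod_congr rfl fun i _ => this i, Finset.prod_const, Finset.card_univ,
    Fintype.card_fin]

section CdfConvergence

/-- Convergence of the cumulative distribution functions at every point implies convergence in
distribution. -/
theorem tendstoInDistribution_of_forall_tendsto_cdf {ι : Type*} {l : Filter ι}
    [l.IsCountablyGenerated] {Ω : ι → Type*} [∀ i, MeasurableSpace (Ω i)]
    {P : (i : ι) → Measure (Ω i)} [∀ i, IsProbabilityMeasure (P i)] {Y : (i : ι) → Ω i → ℝ}
    (hY : ∀ i, AEMeasurable (Y i) (P i)) {ν : Measure ℝ} [IsProbabilityMeasure ν]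
    (h : ∀ x, Tendsto (fun i => (P i).real {ω | Y i ω ≤ x}) l (𝓝 (ν.real (Set.Iic x)))) :
    TendstoInDistribution Y l (fun x : ℝ => x) P ν where
  forall_aemeasurable := hY
  aemeasurable_limit := aemeasurable_id
  tendsto := by
    refine (isPiSystem_Ioc (id : ℝ → ℝ) id).tendsto_probabilityMeasure_of_tendsto_of_mem ?_ ?_ ?_
    · rintro s ⟨a, b, -, rfl⟩
      exact measurableSet_Ioc
    · intro u hu x hx
      obtain ⟨ε, hε, hball⟩ := Metric.isOpen_iff.1 hu x hx
      refine ⟨Set.Ioc (x - ε / 2) (x + ε / 2), ⟨x - ε / 2, x + ε / 2, by simp only [id]; linarith,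
        rfl⟩, Ioc_mem_nhds (by linarith) (by linarith), fun z hz => hball ?_⟩
      rw [Metric.mem_ball, Real.dist_eq, abs_lt]
      constructor <;> linarith [hz.1, hz.2]
    · rintro s ⟨a, b, hab, rfl⟩
      simp only [id] at hab ⊢
      have hIoc : ∀ (ρ : Measure ℝ) [IsProbabilityMeasure ρ],
          ρ.real (Set.Ioc a b) = ρ.real (Set.Iic b) - ρ.real (Set.Iic a) := by
        intro ρ _
        rw [← Set.Iic_sdiff_Iic, measureReal_sdiff (Set.Iic_subset_Iic.2 hab.le) measurableSet_Iic]
      have hmap : ∀ i x, ((P i).map (Y i)).real (Set.Iic x) = (P i).real {ω | Y i ω ≤ x} :=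
        fun i x => map_measureReal_apply_of_aemeasurable (hY i) measurableSet_Iic
      rw [← NNReal.tendsto_coe]
      have hlim := (h b).sub (h a)
      rw [← hIoc] at hlim
      have hmeas : ∀ i, IsProbabilityMeasure ((P i).map (Y i)) := fun i =>
        Measure.isProbabilityMeasure_map (hY i)
      simp_rw [← hmap, ← hIoc] at hlim
      have hlim' : Tendsto (fun i => ((P i).map (Y i)).real (Set.Ioc a b)) l
          (𝓝 ((ν.map fun x : ℝ => x).real (Set.Ioc a b))) := by
        rwa [Measure.map_id']
      exact hlim'

/-- If `X` has asymptotic continuous distribution function `F` and `Y - X → 0` in probability, then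
`Y` has the same asymptotic distribution function. -/
theorem tendsto_measureReal_le_of_tendsto_sub {ι : Type*} {l : Filter ι} {Ω : ι → Type*}
    [∀ i, MeasurableSpace (Ω i)] {P : (i : ι) → Measure (Ω i)} [∀ i, IsProbabilityMeasure (P i)]
    {X Y : (i : ι) → Ω i → ℝ} {F : ℝ → ℝ} (hF : Continuous F)
    (hX : ∀ x, Tendsto (fun i => (P i).real {ω | X i ω ≤ x}) l (𝓝 (F x)))
    (hXY : ∀ ε > 0, Tendsto (fun i => (P i).real {ω | ε ≤ |Y i ω - X i ω|}) l (𝓝 0)) (x : ℝ) :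
    Tendsto (fun i => (P i).real {ω | Y i ω ≤ x}) l (𝓝 (F x)) := by
  rw [tendsto_order]
  have cover : ∀ (i : ι) (ε a b : ℝ) (U V : Ω i → ℝ), a + ε ≤ b →
      (P i).real {ω | U ω ≤ a} ≤ (P i).real {ω | V ω ≤ b} + (P i).real {ω | ε ≤ |V ω - U ω|} := by
    intro i ε a b U V hab
    refine (measureReal_mono fun ω hω => ?_).trans (measureReal_union_le _ _)
    by_cases h : ε ≤ |V ω - U ω|
    · exact Or.inr h
    · refine Or.inl ?_
      have h1 := (abs_lt.1 (not_le.1 h)).2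
      have h2 : U ω ≤ a := hω
      change V ω ≤ b
      linarith
  constructor
  · intro c hc
    have h1 : ∀ᶠ u in 𝓝 x, c < F u := hF.continuousAt.eventually_const_lt hc
    obtain ⟨ε, hε, hball⟩ := Metric.eventually_nhds_iff.1 h1
    have h2 : c < F (x - ε / 2) := hball (by rw [Real.dist_eq, abs_lt]; constructor <;> linarith)
    have h3 := (hX (x - ε / 2)).sub (hXY (ε / 2) (by linarith))
    rw [sub_zero] at h3
    filter_upwards [h3.eventually_const_lt h2] with i hi
    linarith [cover i (ε / 2) (x - ε / 2) x (X i) (Y i) (by linarith)]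
  · intro c hc
    have h1 : ∀ᶠ u in 𝓝 x, F u < c := hF.continuousAt.eventually_lt_const hc
    obtain ⟨ε, hε, hball⟩ := Metric.eventually_nhds_iff.1 h1
    have h2 : F (x + ε / 2) < c := hball (by rw [Real.dist_eq, abs_lt]; constructor <;> linarith)
    have h3 := (hX (x + ε / 2)).add (hXY (ε / 2) (by linarith))
    rw [add_zero] at h3
    filter_upwards [h3.eventually_lt_const h2] with i hi
    have h4 := cover i (ε / 2) x (x + ε / 2) (Y i) (X i) (by linarith)
    simp_rw [abs_sub_comm (X i _) (Y i _)] at h4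
    linarith

end CdfConvergence

section Frechet

/-- The distribution function of the Fréchet law with shape parameter `β`. -/
noncomputable def frechetCdf (β x : ℝ) : ℝ := if x ≤ 0 then 0 else Real.exp (-x ^ (-β))

theorem frechetCdf_of_nonpos {β x : ℝ} (hx : x ≤ 0) : frechetCdf β x = 0 := if_pos hx

theorem frechetCdf_of_pos {β x : ℝ} (hx : 0 < x) : frechetCdf β x = Real.exp (-x ^ (-β)) :=
  if_neg hx.not_ge

theorem frechetCdf_nonneg (β x : ℝ) : 0 ≤ frechetCdf β x := by
  unfold frechetCdf
  split_ifs <;> positivity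

theorem tendsto_exp_neg_rpow_zero {β : ℝ} (hβ : 0 < β) :
    Tendsto (fun x : ℝ => Real.exp (-x ^ (-β))) (𝓝[>] 0) (𝓝 0) := by
  refine Real.tendsto_exp_neg_atTop_nhds_zero.comp ?_
  have h1 : Tendsto (fun x : ℝ => (x⁻¹) ^ β) (𝓝[>] 0) atTop :=
    (tendsto_rpow_atTop hβ).comp tendsto_inv_nhdsGT_zero
  refine h1.congr' ?_
  filter_upwards [self_mem_nhdsWithin] with x hx
  rw [Real.inv_rpow (le_of_lt hx), Real.rpow_neg (le_of_lt hx)]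

theorem continuous_frechetCdf {β : ℝ} (hβ : 0 < β) : Continuous (frechetCdf β) := by
  rw [continuous_iff_continuousAt]
  intro x
  rcases lt_trichotomy x 0 with hx | rfl | hx
  · refine (continuousAt_const (y := (0 : ℝ))).congr ?_
    filter_upwards [Iio_mem_nhds hx] with u hu
    exact (frechetCdf_of_nonpos (le_of_lt hu)).symm
  · rw [continuousAt_iff_continuous_left'_right']
    constructor
    · refine (continuousWithinAt_const (b := (0 : ℝ))).congr (fun u hu => ?_) ?_
      · exact frechetCdf_of_nonpos (le_of_lt hu)
      · exact frechetCdf_of_nonpos le_rfl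
    · change Tendsto _ _ (𝓝 (frechetCdf β 0))
      rw [frechetCdf_of_nonpos le_rfl]
      refine (tendsto_exp_neg_rpow_zero hβ).congr' ?_
      filter_upwards [self_mem_nhdsWithin] with u hu
      exact (frechetCdf_of_pos hu).symm
  · have h1 : ContinuousAt (fun x : ℝ => Real.exp (-x ^ (-β))) x :=
      (Real.continuousAt_rpow_const x (-β) (Or.inl hx.ne')).neg.rexp
    refine h1.congr ?_
    filter_upwards [Ioi_mem_nhds hx] with u hu
    exact (frechetCdf_of_pos hu).symm

theorem monotone_frechetCdf {β : ℝ} (hβ : 0 < β) : Monotone (frechetCdf β) := by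
  intro x z hxz
  rcases le_or_gt x 0 with hx | hx
  · rw [frechetCdf_of_nonpos hx]
    exact frechetCdf_nonneg β z
  · rw [frechetCdf_of_pos hx, frechetCdf_of_pos (hx.trans_le hxz), Real.exp_le_exp, neg_le_neg_iff]
    exact Real.rpow_le_rpow_of_nonpos hx hxz (by linarith)

theorem tendsto_frechetCdf_atBot (β : ℝ) : Tendsto (frechetCdf β) atBot (𝓝 0) := by
  refine tendsto_const_nhds.congr' ?_
  filter_upwards [eventually_le_atBot 0] with x hx
  exact (frechetCdf_of_nonpos hx).symm

theorem tendsto_frechetCdf_atTop {β : ℝ} (hβ : 0 < β) :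
    Tendsto (frechetCdf β) atTop (𝓝 1) := by
  have h1 : Tendsto (fun x : ℝ => Real.exp (-x ^ (-β))) atTop (𝓝 1) := by
    simpa using ((tendsto_rpow_neg_atTop hβ).neg).rexp
  refine h1.congr' ?_
  filter_upwards [eventually_gt_atTop 0] with x hx
  exact (frechetCdf_of_pos hx).symm

/-- Existence of the Fréchet law. -/
theorem exists_measure_Iic_eq_frechetCdf {β : ℝ} (hβ : 0 < β) :
    ∃ ν : Measure ℝ, IsProbabilityMeasure ν ∧ ∀ x, ν.real (Set.Iic x) = frechetCdf β x := by
  let f : StieltjesFunction ℝ :=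
    ⟨frechetCdf β, monotone_frechetCdf hβ, fun x => (continuous_frechetCdf hβ).continuousWithinAt⟩
  refine ⟨f.measure, ⟨?_⟩, fun x => ?_⟩
  · rw [f.measure_univ (tendsto_frechetCdf_atBot β) (tendsto_frechetCdf_atTop hβ)]
    simp
  · rw [measureReal_def, f.measure_Iic (tendsto_frechetCdf_atBot β), sub_zero]
    exact ENNReal.toReal_ofReal (frechetCdf_nonneg β x)

end Frechet

section Assembly

variable {μσ : Measure ℝ} [IsProbabilityMeasure μσ] {α : ℝ} {Ω : ℕ → Type*}
  [∀ T, MeasurableSpace (Ω T)] {P : (T : ℕ) → Measure (Ω T)} [∀ T, IsProbabilityMeasure (P T)]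
  {σ : (T : ℕ) → Fin T → Ω T → ℝ} {a : ℕ → ℝ}

/-- The maximum of `T` independent heavy-tailed squares, divided by `a T`, is asymptotically
Fréchet distributed. -/
theorem HasRegularlyVaryingTail.tendsto_measureReal_norm_sq_div_le
    (h : HasRegularlyVaryingTail μσ α) (hα : 0 < α)
    (ha : ∀ᶠ T : ℕ in atTop, sqTail μσ (a T) = 1 / (T : ℝ))
    (hσ : ∀ T i, HasLaw (σ T i) μσ (P T)) (hind : ∀ T, iIndepFun (σ T) (P T)) (x : ℝ) :
    Tendsto (fun T => (P T).real {ω | ‖fun i => σ T i ω ^ 2‖ / a T ≤ x}) atTop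
      (𝓝 (frechetCdf (α / 2) x)) := by
  have ha' := h.tendsto_atTop_of_sqTail_eq ha
  have hpos : ∀ u : ℝ, 0 < u → Tendsto
      (fun T => (P T).real {ω | ‖fun i => σ T i ω ^ 2‖ / a T ≤ u}) atTop
      (𝓝 (frechetCdf (α / 2) u)) := by
    intro u hu
    have h1 : Tendsto (fun T : ℕ => (T : ℝ) * -sqTail μσ (u * a T)) atTop
        (𝓝 (-u ^ (-(α / 2)))) := by
      simpa using (h.tendsto_mul_sqTail ha hu).neg
    have h2 := Real.tendsto_one_add_pow_exp_of_tendsto h1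
    rw [frechetCdf_of_pos hu]
    refine h2.congr' ?_
    filter_upwards [ha'.eventually_gt_atTop 0] with T hT
    rw [← sub_eq_add_neg, ← measureReal_norm_sq_le (hσ T) (hind T) (by positivity)]
    simp_rw [div_le_iff₀ hT]
  rcases lt_or_ge 0 x with hx | hx
  · exact hpos x hx
  · rw [frechetCdf_of_nonpos hx]
    rw [tendsto_order]
    refine ⟨fun c hc => Eventually.of_forall fun T => hc.trans_le measureReal_nonneg,
      fun c hc => ?_⟩
    have h1 : ∀ᶠ u in 𝓝[>] (0 : ℝ), frechetCdf (α / 2) u < c := by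
      have h2 := (continuous_frechetCdf (half_pos hα)).tendsto 0
      rw [frechetCdf_of_nonpos le_rfl] at h2
      exact (h2.mono_left nhdsWithin_le_nhds).eventually_lt_const hc
    obtain ⟨u, hu, hu0⟩ := (h1.and self_mem_nhdsWithin).exists
    filter_upwards [(hpos u hu0).eventually_lt_const hu] with T hT
    refine lt_of_le_of_lt (measureReal_mono fun ω hω => ?_) hT
    exact le_trans hω (hx.trans (le_of_lt hu0))

variable {𝕜 : Type*} [RCLike 𝕜] {μZ : Measure 𝕜} {S : ℕ → ℕ} {y : ℝ}
  {Z : (T : ℕ) → Fin T → Fin (S T) → Ω T → 𝕜}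

/-- After normalization by `S a`, the largest eigenvalue of `Σ Z Z* Σ` and `S max_i σ_i²` are
close in probability. -/
theorem HasRegularlyVaryingTail.tendsto_measureReal_lambdaMax_sub
    (h : HasRegularlyVaryingTail μσ α) (hα0 : 0 < α) (hα4 : α < 4) (hy : 0 < y)
    (hμ4 : Integrable (fun z : 𝕜 => ‖z‖ ^ 4) μZ) (hμ0 : ∫ z, z ∂μZ = 0)
    (hμ1 : ∫ z, ‖z‖ ^ 2 ∂μZ = 1)
    (hS : Tendsto (fun T : ℕ => (T : ℝ) / (S T : ℝ)) atTop (𝓝 y))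
    (ha : ∀ᶠ T : ℕ in atTop, sqTail μσ (a T) = 1 / (T : ℝ))
    (hσ : ∀ T i, HasLaw (σ T i) μσ (P T)) (hσind : ∀ T, iIndepFun (σ T) (P T))
    (hZ : ∀ T i j, HasLaw (Z T i j) μZ (P T))
    (hind : ∀ T, iIndepFun (fun p : Fin T × Fin (S T) => Z T p.1 p.2) (P T))
    (hσZ : ∀ T, IndepFun (fun ω (i : Fin T) => σ T i ω)
      (fun ω (p : Fin T × Fin (S T)) => Z T p.1 p.2 ω) (P T)) {ε : ℝ} (hε : 0 < ε) :
    Tendsto (fun T => (P T).real {ω | ε ≤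
      |lambdaMax (isHermitian_ellipticMatrix (fun i => σ T i ω)
        (Matrix.of fun i j => Z T i j ω)) / ((S T : ℝ) * a T) - ‖fun i => σ T i ω ^ 2‖ / a T|})
      atTop (𝓝 0) := by
  have ha' := h.tendsto_atTop_of_sqTail_eq ha
  set c : ℝ := 2 * ∫ z, ‖z‖ ^ 4 ∂μZ + 2 with hc
  rw [tendsto_order]
  refine ⟨fun b hb => Eventually.of_forall fun T => hb.trans_le measureReal_nonneg,
    fun b hb => ?_⟩
  obtain ⟨K, hKb, hK1⟩ := (((tendsto_rpow_neg_atTop (half_pos hα0)).eventually_lt_const hb).and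
    (eventually_ge_atTop 1)).exists
  have hK0 : 0 < K := zero_lt_one.trans_le hK1
  have hM := h.tendsto_sqTruncMean_mul_sqrt hα4 ha hK1
  have hlim : Tendsto (fun T : ℕ => T * sqTail μσ (K * a T) + c / ε ^ 2 * ((T : ℝ) / S T *
      ((sqTruncMean μσ (K * a T) * √T / a T) ^ 2
        + K * (sqTruncMean μσ (K * a T) * √T / a T)))) atTop (𝓝 (K ^ (-(α / 2)))) := by
    have h1 := (h.tendsto_mul_sqTail ha hK0).add
      ((hS.mul ((hM.pow 2).add (hM.const_mul K))).const_mul (c / ε ^ 2))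
    simpa using h1
  filter_upwards [hlim.eventually_lt_const hKb, hS.eventually_const_lt hy,
    ha'.eventually_gt_atTop 0, eventually_ge_atTop 1] with T hT hST haT hT1
  refine lt_of_le_of_lt ?_ hT
  have hT0 : (1 : ℝ) ≤ T := by exact_mod_cast hT1
  have hS0 : (0 : ℝ) < S T := by
    rcases (Nat.cast_nonneg (α := ℝ) (S T)).lt_or_eq with h1 | h1
    · exact h1
    · rw [← h1, div_zero] at hST
      exact absurd hST (lt_irrefl 0)
  have hD : 0 < (S T : ℝ) * a T := mul_pos hS0 haT
  have hset : {ω | ε ≤ |lambdaMax (isHermitian_ellipticMatrix (fun i => σ T i ω)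
        (Matrix.of fun i j => Z T i j ω)) / ((S T : ℝ) * a T) - ‖fun i => σ T i ω ^ 2‖ / a T|}
      = {ω | ε * ((S T : ℝ) * a T) ≤ |lambdaMax (isHermitian_ellipticMatrix (fun i => σ T i ω)
        (Matrix.of fun i j => Z T i j ω)) - S T * ‖fun i => σ T i ω ^ 2‖|} := by
    ext ω
    rw [Set.mem_ofPred_eq, Set.mem_ofPred_eq, ← le_div_iff₀ hD]
    have habs : ∀ l w : ℝ, |l - S T * w| / (S T * a T) = |l / (S T * a T) - w / a T| := by
      intro l w
      rw [← mul_div_mul_left w (a T) hS0.ne', ← sub_div, abs_div, abs_of_pos hD]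
    rw [habs]
  rw [hset]
  refine (measureReal_abs_lambdaMax_sub_ge_le (hσ T) (hσind T) hμ4 hμ0 hμ1 (hZ T) (hind T)
    (hσZ T) (x := K * a T) (by positivity) (by positivity)).trans ?_
  have hm0 : 0 ≤ sqTruncMean μσ (K * a T) := sqTruncMean_nonneg (by positivity)
  set M := sqTruncMean μσ (K * a T) with hMdef
  have hc0 : 0 ≤ c := by
    have : 0 ≤ ∫ z, ‖z‖ ^ 4 ∂μZ := integral_nonneg fun z => by positivity
    linarith
  have hsq : √(T : ℝ) ^ 2 = T := Real.sq_sqrt (by linarith)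
  have h1 : M ≤ M * √T := le_mul_of_one_le_right hm0 (Real.one_le_sqrt.2 hT0)
  refine add_le_add le_rfl ?_
  calc (S T : ℝ) * c * ((T : ℝ) ^ 2 * M ^ 2 + T * (K * a T * M)) / (ε * (S T * a T)) ^ 2
      = c / ε ^ 2 * ((T : ℝ) / S T * (T * M ^ 2 / a T ^ 2 + K * (M / a T))) := by
        field_simp
    _ = c / ε ^ 2 * ((T : ℝ) / S T * ((M * √T / a T) ^ 2 + K * (M / a T))) := by
        rw [div_pow, mul_pow, hsq, mul_comm (T : ℝ) (M ^ 2)]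
    _ ≤ _ := by gcongr

end Assembly

theorem theorem3p1 {𝕜 : Type*} [RCLike 𝕜]
    (α y : ℝ) (hα0 : 0 < α) (hα4 : α < 4) (hα2 : α ≠ 2) (hy : 0 < y)
    -- the common law of the `σ_i` and the common law of the entries of `Z`
    (μσ : Measure ℝ) [IsProbabilityMeasure μσ] (hμσ : HasRegularlyVaryingTail μσ α)
    (μZ : Measure 𝕜) [IsProbabilityMeasure μZ]
    (hμZ_moments : ∀ k : ℕ, Integrable (fun z : 𝕜 => ‖z‖ ^ k) μZ)
    (hμZ_mean : ∫ z, z ∂μZ = 0) (hμZ_var : ∫ z, ‖z‖ ^ 2 ∂μZ = 1)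
    -- the dimensions `T × S T`
    (S : ℕ → ℕ) (hS : Tendsto (fun T : ℕ => (T : ℝ) / (S T : ℝ)) atTop (𝓝 y))
    -- the scaling constants: `1 - H (a T) = 1 / T`, with `H` the c.d.f. of `σ_i ^ 2`
    (a : ℕ → ℝ)
    (ha : ∀ᶠ T : ℕ in atTop, 1 - cdf (μσ.map fun s : ℝ => s ^ 2) (a T) = 1 / (T : ℝ))
    -- the random matrices of size index `T`, on a probability space that may vary with `T`
    {Ω : ℕ → Type*} [∀ T, MeasurableSpace (Ω T)] (P : (T : ℕ) → Measure (Ω T))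
    [∀ T, IsProbabilityMeasure (P T)]
    (σ : (T : ℕ) → Fin T → Ω T → ℝ)
    (Z : (T : ℕ) → Fin T → Fin (S T) → Ω T → 𝕜)
    (hσ_law : ∀ T i, HasLaw (σ T i) μσ (P T))
    (hσ_indep : ∀ T, iIndepFun (σ T) (P T))
    (hZ_law : ∀ T i j, HasLaw (Z T i j) μZ (P T))
    (hZ_indep : ∀ T, iIndepFun (fun p : Fin T × Fin (S T) => Z T p.1 p.2) (P T))
    (hσZ_indep : ∀ T, IndepFun (fun ω (i : Fin T) => σ T i ω)
      (fun ω (p : Fin T × Fin (S T)) => Z T p.1 p.2 ω) (P T)) :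
    ∃ (ν : Measure ℝ) (_ : IsProbabilityMeasure ν),
      (∀ x : ℝ, 0 < x → ν.real (Set.Iic x) = Real.exp (-x ^ (-(α / 2)))) ∧
      (∀ x : ℝ, x ≤ 0 → ν.real (Set.Iic x) = 0) ∧
      TendstoInDistribution
        (fun (T : ℕ) (ω : Ω T) =>
          lambdaMax (isHermitian_ellipticMatrix (fun i => σ T i ω)
            (Matrix.of fun i j => Z T i j ω)) / ((S T : ℝ) * a T))
        atTop (fun x : ℝ => x) P ν := by
  simp_rw [one_sub_cdf_map_sq] at ha
  obtain ⟨ν, hν, hcdf⟩ := exists_measure_Iic_eq_frechetCdf (half_pos hα0)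
  refine ⟨ν, hν, fun x hx => by rw [hcdf, frechetCdf_of_pos hx],
    fun x hx => by rw [hcdf, frechetCdf_of_nonpos hx], ?_⟩
  refine tendstoInDistribution_of_forall_tendsto_cdf (fun T => ?_) fun x => ?_
  · have h1 : AEMeasurable (fun ω (i : Fin T) => σ T i ω) (P T) :=
      aemeasurable_pi_lambda _ fun i => (hσ_law T i).aemeasurable
    have h2 : AEMeasurable (fun ω (p : Fin T × Fin (S T)) => Z T p.1 p.2 ω) (P T) :=
      aemeasurable_pi_lambda _ fun p => (hZ_law T _ _).aemeasurable
    exact (continuous_lambdaMax_ellipticMatrix.measurable.comp_aemeasurable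
      (h1.prodMk h2)).div_const _
  · rw [hcdf]
    exact tendsto_measureReal_le_of_tendsto_sub (continuous_frechetCdf (half_pos hα0))
      (hμσ.tendsto_measureReal_norm_sq_div_le hα0 ha hσ_law hσ_indep)
      (fun ε hε => hμσ.tendsto_measureReal_lambdaMax_sub hα0 hα4 hy (hμZ_moments 4) hμZ_mean
        hμZ_var hS ha hσ_law hσ_indep hZ_law hZ_indep hσZ_indep hε) x
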